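/- Let $A$ be a free group of finite rank with free basis $\mathcal A$, and let $T$ be its Cayley graph with respect to $\mathcal A$, a tree with vertex set $A$, with the path metric in which every edge has length $1$. Let $B$ be a group and $\varphi: A\to \mathrm{Aut}(B)$ a homomorphism such that $G=B\rtimes_\varphi A$ is finitely generated, and let $\rho$ be the isometric action of $G$ on $T$ obtained by composing the projection $G\to A$ with left translation. For a geodesic ray $\tau:[0,\infty)\to T$ and $k\in\mathbb R$ let $HB_k(\tau)=\bigcup_{l\ge\max\{0,k\}}\overline{\mathrm{Ball}}_{l-k}(\tau(l))$, and for $k\in\mathbb Z$ let $A_k(\tau)\subseteq A$ be the set of vertices of $T$ in $HB_k(\tau)$. Let $\tau(\infty)\in\partial T$ be the boundary point (class of asymptotic rays) represented by $\tau$. For $A'\subseteq A$, a subset $S\subseteq B$ generates $B$ over $A'$ if $\{\varphi_a(s)\mid s\in S,\ a\in A'\}$ generates the group $B$, and $B$ is finitely generated over $A'$ if some finite $S\subseteq B$ generates $B$ over $A'$. The set $\Sigma^1(\rho)\subseteq\partial T$ is defined as follows. Choose a contractible free $G$-CW complex $\tilde X$ (the universal cover of a $K(G,1)$-complex) with cocompact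 $1$-skeleton $\tilde X^{(1)}$, and a continuous $G$-map $h:\tilde X^{(1)}\to T$. For $t\in\mathbb R$ let $\tilde X_{(\tau,t)}$ be the largest subcomplex of $\tilde X^{(1)}$ contained in $h^{-1}(HB_t(\tau))$. Then $\tau(\infty)\in\Sigma^1(\rho)$ if there is $\lambda:\mathbb R\to[0,\infty)$ such that $t-\lambda(t)\to\infty$ as $t\to\infty$ and, for every $t\in\mathbb R$, any two points of $\tilde X_{(\tau,t)}$ can be joined by a path in $\tilde X_{(\tau,t-\lambda(t))}$. Then, for every choice of $\tilde X$ and $h$ and every geodesic ray $\tau$ in $T$: (i) If there is a finite set $S\subseteq B$ such that for every integer $k\ge 0$ the set $S$ generates $B$ over $A_k(\tau)$, then $\tau(\infty)\in\Sigma^1(\rho)$. (ii) If for every integer $k\le 0$ the group $B$ is not finitely generated over $A_k(\tau)$, then $\tau(\infty)\notin\Sigma^1(\rho)$. -/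

import Mathlib

noncomputable section

/-! ### Geodesic rays, boundary, horoballs -/

/-- A geodesic ray in a metric space: an isometric embedding of `[0, ∞)`. -/
structure GeodesicRay (M : Type*) [MetricSpace M] where
  toFun : NNReal → M
  isometry : Isometry toFun

/-- Two geodesic rays are asymptotic if they stay at bounded distance from each other. -/
def geodesicRaySetoid (M : Type*) [MetricSpace M] : Setoid (GeodesicRay M) where
  r τ σ := ∃ C : ℝ, ∀ l : NNReal, dist (τ.toFun l) (σ.toFun l) ≤ C
  iseqv :=
    { refl := fun τ => ⟨0, fun l => (dist_self (τ.toFun l)).le⟩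
      symm := fun {τ σ} h => by
        obtain ⟨C, hC⟩ := h
        exact ⟨C, fun l => by rw [dist_comm]; exact hC l⟩
      trans := fun {τ σ υ} h h' => by
        obtain ⟨C, hC⟩ := h
        obtain ⟨C', hC'⟩ := h'
        exact ⟨C + C', fun l =>
          (dist_triangle _ (σ.toFun l) _).trans (add_le_add (hC l) (hC' l))⟩ }

/-- The boundary at infinity `∂M`: geodesic rays up to being asymptotic. -/
def Boundary (M : Type*) [MetricSpace M] : Type _ := Quotient (geodesicRaySetoid M)

/-- The point `τ(∞)` of the boundary represented by the geodesic ray `τ`. -/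
def GeodesicRay.endpoint {M : Type*} [MetricSpace M] (τ : GeodesicRay M) : Boundary M :=
  Quotient.mk (geodesicRaySetoid M) τ

/-- The horoball `HB_k(τ)`: the nested union of the closed balls of radius `l - k` about `τ(l)`,
for `l ≥ max {0, k}`. It shrinks towards `τ(∞)` as `k` increases. -/
def horoball {M : Type*} [MetricSpace M] (τ : GeodesicRay M) (k : ℝ) : Set M :=
  ⋃ (l : NNReal) (_ : k ≤ (l : ℝ)), Metric.closedBall (τ.toFun l) ((l : ℝ) - k)

/-! ### Controlled connectivity and `Σ¹` -/

/-- The data chosen in order to compute `Σ¹(ρ)` for an isometric action `ρ` of `G` on `M`: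
a contractible free `G`-CW complex `X` (that is, the universal cover of a `K(G,1)`-complex) whose
`1`-skeleton is cocompact, and a continuous `G`-map `h` from the `1`-skeleton of `X` to `M`.
The values of `h` outside of the `1`-skeleton play no role. -/
structure ControlData {G M : Type*} [Group G] [MetricSpace M] (ρ : G →* (M ≃ᵢ M)) where
  /-- the total space -/
  X : Type*
  [top : TopologicalSpace X]
  [t2 : T2Space X]
  [contractible : ContractibleSpace X]
  [cw : Topology.CWComplex (Set.univ : Set X)]
  [act : MulAction G X]
  [contAct : ContinuousConstSMul G X]
  /-- `G` permutes the open cells. -/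
  cellular : ∀ (g : G) (n : ℕ) (i : Topology.RelCWComplex.cell (Set.univ : Set X) n),
    ∃ j : Topology.RelCWComplex.cell (Set.univ : Set X) n,
      (fun x : X => g • x) '' Topology.RelCWComplex.openCell n i = Topology.RelCWComplex.openCell n j
  /-- The permutation action on the open cells is free. -/
  free : ∀ (g : G) (n : ℕ) (i : Topology.RelCWComplex.cell (Set.univ : Set X) n),
    (fun x : X => g • x) '' Topology.RelCWComplex.openCell n i = Topology.RelCWComplex.openCell n i → g = 1
  /-- The `1`-skeleton is cocompact: there are finitely many `G`-orbits of cells of dimension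
  at most `1`. -/
  cocompact : ∀ n : ℕ, n ≤ 1 → ∃ F : Set (Topology.RelCWComplex.cell (Set.univ : Set X) n), F.Finite ∧
    ∀ i : Topology.RelCWComplex.cell (Set.univ : Set X) n, ∃ j ∈ F, ∃ g : G,
      (fun x : X => g • x) '' Topology.RelCWComplex.openCell n j = Topology.RelCWComplex.openCell n i
  /-- the control map -/
  h : X → M
  continuousOn_h : ContinuousOn h (Topology.RelCWComplex.skeleton (Set.univ : Set X) 1 : Set X)
  equivariant_h : ∀ (g : G), ∀ x ∈ (Topology.RelCWComplex.skeleton (Set.univ : Set X) 1 : Set X),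
    h (g • x) = ρ g (h x)

attribute [instance] ControlData.top ControlData.t2 ControlData.contractible ControlData.cw
  ControlData.act ControlData.contAct

namespace ControlData

variable {G M : Type*} [Group G] [MetricSpace M] {ρ : G →* (M ≃ᵢ M)}

/-- `X_(τ,t)`: the largest subcomplex of the `1`-skeleton that is contained in `h⁻¹(HB_t(τ))`,
as the union of all such subcomplexes. -/
def sublevel (𝒟 : ControlData ρ) (τ : GeodesicRay M) (t : ℝ) : Set 𝒟.X :=
  {x | ∃ E : Topology.RelCWComplex.Subcomplex (Set.univ : Set 𝒟.X),
    (E : Set 𝒟.X) ⊆ (Topology.RelCWComplex.skeleton (Set.univ : Set 𝒟.X) 1 : Set 𝒟.X) ∧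
    (E : Set 𝒟.X) ⊆ 𝒟.h ⁻¹' horoball τ t ∧ x ∈ (E : Set 𝒟.X)}

/-- The control map is controlled connected over `τ(∞)`: there is a lag `lag t ≥ 0` with
`t - lag t → ∞` as `t → ∞`, such that any two points of `X_(τ,t)` can be joined by a path in
`X_(τ,t - lag t)`. -/
def IsControlledConnected (𝒟 : ControlData ρ) (τ : GeodesicRay M) : Prop :=
  ∃ lag : ℝ → ℝ, (∀ t, 0 ≤ lag t) ∧ Filter.Tendsto (fun t => t - lag t) Filter.atTop Filter.atTop ∧
    ∀ t : ℝ, ∀ x ∈ 𝒟.sublevel τ t, ∀ y ∈ 𝒟.sublevel τ t,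
      JoinedIn (𝒟.sublevel τ (t - lag t)) x y

/-- `Σ¹(ρ)`, computed by means of the data `𝒟`: the set of all boundary points over which the
control map is controlled connected. -/
def Sigma1 (𝒟 : ControlData ρ) : Set (Boundary M) :=
  {e | ∃ τ : GeodesicRay M, τ.endpoint = e ∧ 𝒟.IsControlledConnected τ}

end ControlData

/-! ### The Cayley tree of a free group -/

section CayleyTree

variable {ι A : Type*} [Group A]

open Classical in
/-- The word metric on `A` with respect to the free basis `b`. -/
def wordDist (b : FreeGroupBasis ι A) (a c : A) : ℕ := FreeGroup.norm (b.repr (a⁻¹ * c))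

/-- The geometric realization of the Cayley graph of `A` with respect to the free basis `b`:
points are given by barycentric coordinates on the vertex set `A`, supported on a vertex or on
the two endpoints of an edge. -/
@[ext]
structure CayleyTree (b : FreeGroupBasis ι A) where
  coord : A →₀ ℝ
  nonneg : ∀ a, 0 ≤ coord a
  sum_eq_one : (coord.sum fun _ m => m) = 1
  supported : ∃ a c : A, (a = c ∨ (SimpleGraph.mulCayley (Set.range b)).Adj a c) ∧
    (coord.support : Set A) ⊆ {a, c}

namespace CayleyTree

variable {b : FreeGroupBasis ι A}

/-- The vertex of the Cayley tree given by a group element. -/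
def vertex (b : FreeGroupBasis ι A) (a : A) : CayleyTree b where
  coord := Finsupp.single a 1
  nonneg := fun c => by
    classical
    rw [Finsupp.single_apply]; split_ifs <;> norm_num
  sum_eq_one := by simp
  supported := ⟨a, a, Or.inl rfl, by
    intro c hc
    have := Finsupp.support_single_subset hc
    simpa using this⟩

/-- The distance of a point to a vertex `v`: on each edge it is the affine extension of the word
metric, because in a tree the distances of the two endpoints of an edge to `v` differ by one. -/
def vertexDist (x : CayleyTree b) (v : A) : ℝ := x.coord.sum fun w m => m * (wordDist b w v : ℝ)

end CayleyTree


theorem wordDist_self (b : FreeGroupBasis ι A) (a : A) : wordDist b a a = 0 := by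
  simp [wordDist]

theorem wordDist_eq_zero (b : FreeGroupBasis ι A) {a c : A} (h : wordDist b a c = 0) :
    a = c := by
  classical
  have h1 : b.repr (a⁻¹ * c) = 1 := FreeGroup.norm_eq_zero.mp h
  exact inv_mul_eq_one.mp ((MulEquiv.map_eq_one_iff b.repr).mp h1)

theorem wordDist_comm (b : FreeGroupBasis ι A) (a c : A) : wordDist b a c = wordDist b c a := by
  classical
  unfold wordDist
  rw [← FreeGroup.norm_inv_eq, ← map_inv]
  simp

theorem wordDist_triangle (b : FreeGroupBasis ι A) (a c d : A) :
    wordDist b a d ≤ wordDist b a c + wordDist b c d := by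
  classical
  unfold wordDist
  have h : a⁻¹ * d = (a⁻¹ * c) * (c⁻¹ * d) := by group
  rw [h, map_mul]
  exact FreeGroup.norm_mul_le _ _

theorem wordDist_mul_left (b : FreeGroupBasis ι A) (g a c : A) :
    wordDist b (g * a) (g * c) = wordDist b a c := by
  unfold wordDist
  congr 2
  group

theorem wordDist_of_adj (b : FreeGroupBasis ι A) {a c : A}
    (h : (SimpleGraph.mulCayley (Set.range b)).Adj a c) : wordDist b a c = 1 := by
  have key : ∀ (a : A) (i : ι), wordDist b a (a * b i) = 1 := by
    intro a i
    simp [wordDist]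
  rw [SimpleGraph.mulCayley_adj'] at h
  obtain ⟨-, g, ⟨i, rfl⟩, h | h⟩ := h
  · rw [← h]; exact key a i
  · rw [wordDist_comm, h]; exact key c i

theorem wordDist_cast_triangle (b : FreeGroupBasis ι A) (a c d : A) :
    (wordDist b a d : ℝ) ≤ wordDist b a c + wordDist b c d := by
  exact_mod_cast wordDist_triangle b a c d

namespace CayleyTree

variable {b : FreeGroupBasis ι A}

theorem abs_vertexDist_sub_le (x : CayleyTree b) (v : A) :
    |x.vertexDist v - wordDist b 1 v| ≤ x.vertexDist 1 := by
  have h1 : (wordDist b 1 v : ℝ) = x.coord.sum fun _ m => m * (wordDist b 1 v : ℝ) := by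
    have := x.sum_eq_one
    unfold Finsupp.sum at this ⊢
    rw [← Finset.sum_mul, this, one_mul]
  rw [h1]
  unfold vertexDist Finsupp.sum
  rw [← Finset.sum_sub_distrib]
  refine (Finset.abs_sum_le_sum_abs _ _).trans (Finset.sum_le_sum fun w _ => ?_)
  rw [← mul_sub, abs_mul, abs_of_nonneg (x.nonneg w)]
  refine mul_le_mul_of_nonneg_left ?_ (x.nonneg w)
  have h2 := wordDist_cast_triangle b w 1 v
  have h3 := wordDist_cast_triangle b 1 w v
  rw [wordDist_comm b 1 w] at h3
  rw [abs_le]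
  constructor <;> linarith

theorem bddAbove_vertexDist (x y : CayleyTree b) :
    BddAbove (Set.range fun v : A => |x.vertexDist v - y.vertexDist v|) := by
  refine ⟨x.vertexDist 1 + y.vertexDist 1, ?_⟩
  rintro _ ⟨v, rfl⟩
  have h1 := abs_le.mp (abs_vertexDist_sub_le x v)
  have h2 := abs_le.mp (abs_vertexDist_sub_le y v)
  simp only [abs_le]
  constructor <;> linarith [h1.1, h1.2, h2.1, h2.2]

theorem sum_of_subset (y : CayleyTree b) {a c : A} (hne : a ≠ c)
    (h : (y.coord.support : Set A) ⊆ {a, c}) (f : A → ℝ) :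
    (y.coord.sum fun w m => m * f w) = y.coord a * f a + y.coord c * f c := by
  classical
  have h' : y.coord.support ⊆ ({a, c} : Finset A) := by
    intro w hw
    have := h hw
    simpa using this
  rw [Finsupp.sum_of_support_subset _ h' _ (by simp), Finset.sum_pair hne]

/-- A point is determined by its distances to the vertices. -/
theorem ext_vertexDist {x y : CayleyTree b} (h : ∀ v, x.vertexDist v = y.vertexDist v) :
    x = y := by
  classical
  obtain ⟨a, c, hac, hx⟩ := x.supported
  have hD : wordDist b a c ≤ 1 := by
    rcases hac with rfl | hac
    · simp [wordDist_self]
    · exact (wordDist_of_adj b hac).le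
  have hsum : ∀ z : CayleyTree b, z.vertexDist a + z.vertexDist c - wordDist b a c =
      ∑ w ∈ z.coord.support,
        z.coord w * ((wordDist b w a : ℝ) + wordDist b w c - wordDist b a c) := by
    intro z
    have hz := z.sum_eq_one
    unfold vertexDist
    unfold Finsupp.sum at hz ⊢
    simp only [mul_sub, mul_add, Finset.sum_sub_distrib, Finset.sum_add_distrib,
      ← Finset.sum_mul, hz, one_mul]
  have hx0 : x.vertexDist a + x.vertexDist c - wordDist b a c = 0 := by
    rw [hsum]
    refine Finset.sum_eq_zero fun w hw => ?_
    have hw' : w = a ∨ w = c := by simpa using hx hw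
    rcases hw' with rfl | rfl
    · simp [wordDist_self]
    · simp [wordDist_self, wordDist_comm b a w]
  have hy : (y.coord.support : Set A) ⊆ {a, c} := by
    have hy0 := hx0
    rw [h a, h c, hsum, Finset.sum_eq_zero_iff_of_nonneg] at hy0
    · intro w hw
      by_contra hne
      simp only [Set.mem_insert_iff, Set.mem_singleton_iff, not_or] at hne
      have h1 := hy0 w hw
      have h2 : y.coord w ≠ 0 := by simpa using hw
      have h3 : 1 ≤ wordDist b w a :=
        Nat.one_le_iff_ne_zero.mpr fun h0 => hne.1 (wordDist_eq_zero b h0)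
      have h4 : 1 ≤ wordDist b w c :=
        Nat.one_le_iff_ne_zero.mpr fun h0 => hne.2 (wordDist_eq_zero b h0)
      rcases mul_eq_zero.mp h1 with h5 | h5
      · exact h2 h5
      · have h6 : (1 : ℝ) ≤ wordDist b w a := by exact_mod_cast h3
        have h7 : (1 : ℝ) ≤ wordDist b w c := by exact_mod_cast h4
        have h8 : (wordDist b a c : ℝ) ≤ 1 := by exact_mod_cast hD
        linarith
    · intro w _
      refine mul_nonneg (y.nonneg w) ?_
      have := wordDist_cast_triangle b a w c
      rw [wordDist_comm b a w] at this
      linarith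
  have hsx := x.sum_eq_one
  have hsy := y.sum_eq_one
  have hout : ∀ z : CayleyTree b, (z.coord.support : Set A) ⊆ {a, c} →
      ∀ w, w ≠ a → w ≠ c → z.coord w = 0 := by
    intro z hz w hwa hwc
    by_contra hne
    have : w = a ∨ w = c := by simpa using hz (Finsupp.mem_support_iff.mpr hne)
    tauto
  by_cases hne : a = c
  · have hone : ∀ z : CayleyTree b, (z.coord.support : Set A) ⊆ {a, c} → z.coord a = 1 := by
      intro z hz
      have hz' : z.coord.support ⊆ ({a} : Finset A) := by
        intro w hw
        have : w = a ∨ w = c := by simpa using hz hw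
        rw [← hne] at this
        simpa using this
      have := z.sum_eq_one
      rw [Finsupp.sum_of_support_subset _ hz' _ (by simp)] at this
      simpa using this
    ext w
    by_cases hw : w = a
    · rw [hw, hone x hx, hone y hy]
    · rw [hout x hx w hw (hne ▸ hw), hout y hy w hw (hne ▸ hw)]
  · have hac1 : wordDist b c a = 1 := by
      rw [wordDist_comm]
      exact wordDist_of_adj b (hac.resolve_left hne)
    have hca : x.coord c = y.coord c := by
      have := h a
      unfold vertexDist at this
      rw [sum_of_subset x hne hx, sum_of_subset y hne hy, hac1, wordDist_self] at this
      simpa using this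
    have haa : x.coord a = y.coord a := by
      have hX := sum_of_subset x hne hx fun _ => 1
      have hY := sum_of_subset y hne hy fun _ => 1
      simp only [mul_one] at hX hY
      rw [hsx] at hX
      rw [hsy] at hY
      linarith
    ext w
    by_cases hwa : w = a
    · rw [hwa, haa]
    · by_cases hwc : w = c
      · rw [hwc, hca]
      · rw [hout x hx w hwa hwc, hout y hy w hwa hwc]

/-- The path metric of the Cayley tree, in which every edge has length one. In a tree, the
geodesic from `y` to `x` can be prolonged (within the edge of `x`) to a geodesic that ends in a
vertex, whence the distance of `x` and `y` is the largest difference of their distances to a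
vertex. -/
instance instMetricSpace (b : FreeGroupBasis ι A) : MetricSpace (CayleyTree b) where
  dist x y := ⨆ v : A, |x.vertexDist v - y.vertexDist v|
  dist_self x := by simp
  dist_comm x y := by simp only [abs_sub_comm]
  dist_triangle x y z := by
    refine ciSup_le fun v => ?_
    refine (abs_sub_le _ (y.vertexDist v) _).trans (add_le_add ?_ ?_)
    · exact le_ciSup (bddAbove_vertexDist x y) v
    · exact le_ciSup (bddAbove_vertexDist y z) v
  eq_of_dist_eq_zero := by
    intro x y h
    refine ext_vertexDist fun v => ?_
    have h1 : |x.vertexDist v - y.vertexDist v| ≤ 0 := by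
      rw [← h]
      exact le_ciSup (bddAbove_vertexDist x y) v
    exact sub_eq_zero.mp (abs_eq_zero.mp (le_antisymm h1 (abs_nonneg _)))

theorem dist_def (x y : CayleyTree b) :
    dist x y = ⨆ v : A, |x.vertexDist v - y.vertexDist v| := rfl

/-- Left translation of the Cayley tree by a group element. -/
def translate (g : A) (x : CayleyTree b) : CayleyTree b where
  coord := Finsupp.equivMapDomain (Equiv.mulLeft g) x.coord
  nonneg := fun a => by
    rw [Finsupp.equivMapDomain_apply]
    exact x.nonneg _
  sum_eq_one := by
    rw [Finsupp.sum_equivMapDomain]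
    exact x.sum_eq_one
  supported := by
    obtain ⟨a, c, hac, hx⟩ := x.supported
    refine ⟨g * a, g * c, ?_, ?_⟩
    · rcases hac with rfl | hac
      · exact Or.inl rfl
      · right
        rw [SimpleGraph.mulCayley_adj'] at hac ⊢
        obtain ⟨hne, s, hs, h⟩ := hac
        refine ⟨fun h => hne (mul_left_cancel h), s, hs, ?_⟩
        rcases h with h | h
        · left; rw [mul_assoc, h]
        · right; rw [mul_assoc, ← h]
    · intro w hw
      have h1 : g⁻¹ * w ∈ x.coord.support := by
        have h2 : Finsupp.equivMapDomain (Equiv.mulLeft g) x.coord w ≠ 0 := by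
          simpa using hw
        rw [Finsupp.equivMapDomain_apply] at h2
        simpa using h2
      have h3 : g⁻¹ * w = a ∨ g⁻¹ * w = c := by simpa using hx h1
      rcases h3 with h3 | h3
      · left; rw [← h3]; simp
      · right; rw [Set.mem_singleton_iff, ← h3]; simp

theorem translate_mul (g g' : A) (x : CayleyTree b) :
    translate (g * g') x = translate g (translate g' x) := by
  ext w
  simp only [translate, Finsupp.equivMapDomain_apply, Equiv.mulLeft_symm, Equiv.coe_mulLeft,
    mul_inv_rev, mul_assoc]

theorem translate_one (x : CayleyTree b) : translate 1 x = x := by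
  ext w
  simp only [translate, Finsupp.equivMapDomain_apply, Equiv.mulLeft_symm, Equiv.coe_mulLeft,
    inv_one, one_mul]

theorem vertexDist_translate (g : A) (x : CayleyTree b) (v : A) :
    (translate g x).vertexDist (g * v) = x.vertexDist v := by
  unfold vertexDist translate
  simp only [Finsupp.sum_equivMapDomain, Equiv.coe_mulLeft, wordDist_mul_left]

theorem isometry_translate (g : A) : Isometry (translate g : CayleyTree b → CayleyTree b) := by
  refine Isometry.of_dist_eq fun x y => ?_
  rw [dist_def, dist_def, ← (Equiv.mulLeft g).iSup_comp]
  simp only [Equiv.coe_mulLeft, vertexDist_translate]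

/-- The action of `A` on its Cayley tree by left translations. -/
def action (b : FreeGroupBasis ι A) : A →* (CayleyTree b ≃ᵢ CayleyTree b) where
  toFun g :=
    { toFun := translate g
      invFun := translate g⁻¹
      left_inv := fun x => by rw [← translate_mul, inv_mul_cancel, translate_one]
      right_inv := fun x => by rw [← translate_mul, mul_inv_cancel, translate_one]
      isometry_toFun := isometry_translate g }
  map_one' := by
    ext1 x
    exact translate_one x
  map_mul' := fun g g' => by
    ext1 x
    exact translate_mul g g' x

end CayleyTree

/-- The action `ρ` of `G = B ⋊[φ] A` on the Cayley tree of `A` that is induced by the projection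
`G → A`. -/
def semidirectAction {B : Type*} [Group B] (b : FreeGroupBasis ι A) (φ : A →* MulAut B) :
    (B ⋊[φ] A) →* (CayleyTree b ≃ᵢ CayleyTree b) :=
  (CayleyTree.action b).comp SemidirectProduct.rightHom

/-- `A_k(τ)`: the group elements that are vertices of the horoball `HB_k(τ)`. -/
def horoballVertices (b : FreeGroupBasis ι A) (τ : GeodesicRay (CayleyTree b)) (k : ℤ) : Set A :=
  {a | CayleyTree.vertex b a ∈ horoball τ (k : ℝ)}

/-- `S` generates `B` over the subset `A'` of `A`: the elements `a s a⁻¹ = φ_a(s)` with `s ∈ S`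
and `a ∈ A'` generate the group `B`. -/
def GeneratesOver {B : Type*} [Group B] (φ : A →* MulAut B) (S : Set B) (A' : Set A) : Prop :=
  Subgroup.closure {x : B | ∃ s ∈ S, ∃ a ∈ A', x = φ a s} = ⊤

/-- `B` is finitely generated over the subset `A'` of `A`. -/
def FinitelyGeneratedOver {B : Type*} [Group B] (φ : A →* MulAut B) (A' : Set A) : Prop :=
  ∃ S : Set B, S.Finite ∧ GeneratesOver φ S A'

end CayleyTree

end

/-! ### Vertex sets of CW complexes that are closed under adjacency -/

section CWComplex

open Topology Topology.RelCWComplex Metric Set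

variable {X : Type*} [TopologicalSpace X] {C : Set X} [CWComplex C]

/-! The kernel `B` of `G → A` acts trivially on the tree. Over the tree, `G` therefore looks like a
stack of sheets, one for each `γ` in `B`: the element `inl γ * inr a` lies in sheet `γ` over the
vertex `a`. Right multiplication by a basis element moves along an edge of the sheet; right
multiplication by `s` in `B` leads over the same vertex `a` from sheet `γ` to sheet `γ * φ a s`.
Linking all sheets over a horoball thus amounts to generating `B` by the elements `φ a s` with `a`
in that horoball.

For (i), vertices of a horoball are linked inside a sheet along tree geodesics, and sheets are
linked by the generators (`rel_of_generatesOver`). Each such move is realised in `X` by a path of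
bounded control, uniformly over the group (`exists_uniform_near`). Since one finite `S` serves all
horoballs, the lag is constant.

For (ii), the `B`-translates of a vertex all have the same control value, hence lie in one sublevel
set. A path joining two of them follows translates of finitely many edges, and the changes of sheet
along these edges form a finite set generating `B` over a larger horoball
(`finitelyGeneratedOver_of_isControlledConnected`).

Both directions pass from topology to edges through `mem_of_isPreconnected`, applied to all of `X`
in (i) and to a sublevel set in (ii). -/

theorem nonempty_vertex_of_cell (n : ℕ) (e : cell C n) : Nonempty (cell C 0) := by
  induction n using Nat.strong_induction_on with
  | _ n ih =>
    by_cases hn : n = 0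
    · subst hn
      exact ⟨e⟩
    · obtain ⟨x, hx⟩ := nonempty_cellFrontier hn e
      obtain ⟨I, hI⟩ := CWComplex.cellFrontier_subset_finite_openCell n e
      have h := hI hx
      simp only [mem_iUnion] at h
      obtain ⟨m, hm, j, -, -⟩ := h
      exact ih m hm j

theorem exists_lt_mem_openCell {n : ℕ} {e : cell C n} {x : X} (hx : x ∈ cellFrontier n e) :
    ∃ m < n, ∃ j : cell C m, x ∈ openCell m j := by
  obtain ⟨I, hI⟩ := CWComplex.cellFrontier_subset_finite_openCell n e
  have h := hI hx
  simp only [mem_iUnion] at h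
  obtain ⟨m, hm, j, -, h⟩ := h
  exact ⟨m, hm, j, h⟩

theorem sigma_eq_of_mem_openCell {n m : ℕ} {i : cell C n} {j : cell C m} {x : X}
    (hi : x ∈ openCell n i) (hj : x ∈ openCell m j) : (⟨n, i⟩ : Σ n, cell C n) = ⟨m, j⟩ :=
  eq_of_not_disjoint_openCell (Set.not_disjoint_iff.mpr ⟨x, hi, hj⟩)

/-- The cells that are attached, possibly through other cells, to a vertex in `K`. -/
inductive Coloured (K : Set (cell C 0)) : ∀ n : ℕ, cell C n → Prop
  | vertex (v : cell C 0) (hv : v ∈ K) : Coloured K 0 v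
  | attach (n m : ℕ) (e : cell C n) (e' : cell C m) (hm : m < n) (h : Coloured K m e')
      (hne : (cellFrontier n e ∩ openCell m e').Nonempty) : Coloured K n e

theorem coloured_zero_iff {K : Set (cell C 0)} {v : cell C 0} : Coloured K 0 v ↔ v ∈ K := by
  refine ⟨fun h => ?_, Coloured.vertex v⟩
  cases h with
  | vertex _ h => exact h
  | attach _ m _ _ hm _ _ => omega

/-- The frontier is the image of a sphere of dimension `n - 1 ≥ 1`. For `n = 1` the sphere is a pair
of points, which is why edges need the separate hypothesis `hK` below. -/
theorem isPreconnected_cellFrontier {n : ℕ} (hn : 2 ≤ n) (e : cell C n) :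
    IsPreconnected (cellFrontier n e) := by
  refine (isPreconnected_sphere ?_ _ _).image _
    ((RelCWComplex.continuousOn n e).mono sphere_subset_closedBall)
  rw [rank_fin_fun]
  exact_mod_cast hn

theorem isPathConnected_closedCell (n : ℕ) (e : cell C n) : IsPathConnected (closedCell n e) :=
  ((convex_closedBall _ _).isPathConnected (nonempty_closedBall.2 zero_le_one)).image'
    (RelCWComplex.continuousOn n e)

variable [T2Space X]

/-- Induction on the dimension of `e`. For a `1`-cell this is `hK`. In higher dimensions the
connected frontier cannot be split between coloured and uncoloured cells: a point common to closed
cells of both kinds would lie in an open cell whose colour, by induction, agrees with both. -/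
theorem coloured_iff_of_mem {K : Set (cell C 0)}
    (hK : ∀ (e : cell C 1) (v w : cell C 0), map 0 v ![] ∈ cellFrontier 1 e →
      map 0 w ![] ∈ cellFrontier 1 e → v ∈ K → w ∈ K)
    (n : ℕ) (e : cell C n) (m : ℕ) (e' : cell C m) (x : X) (hx : x ∈ closedCell n e)
    (hx' : x ∈ openCell m e') : Coloured K m e' ↔ Coloured K n e := by
  induction n using Nat.strong_induction_on generalizing m e' x with
  | _ n ih =>
    rw [← cellFrontier_union_openCell_eq_closedCell] at hx
    rcases hx with hx | hx
    swap
    · cases sigma_eq_of_mem_openCell hx hx'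
      rfl
    have key : ∀ {y : X} {k : ℕ} {j : cell C k}, y ∈ cellFrontier n e → y ∈ openCell k j →
        k < n := by
      intro y k j hy hj
      obtain ⟨k', hk', j', hj'⟩ := exists_lt_mem_openCell hy
      cases sigma_eq_of_mem_openCell hj hj'
      exact hk'
    refine ⟨fun h => .attach n m e e' (key hx hx') h ⟨x, hx, hx'⟩, fun h => ?_⟩
    have hm := key hx hx'
    cases h with
    | vertex => omega
    | attach _ k _ e₁ hk h₁ hne =>
      obtain ⟨y, hy, hy'⟩ := hne
      by_cases hn : n = 1
      · subst hn
        obtain rfl : m = 0 := by omega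
        obtain rfl : k = 0 := by omega
        rw [openCell_zero_eq_singleton, mem_singleton_iff] at hx' hy'
        subst hx' hy'
        exact coloured_zero_iff.2 (hK e _ _ hy hx (coloured_zero_iff.1 h₁))
      · by_contra hcol
        obtain ⟨I, hI⟩ := CWComplex.cellFrontier_subset_finite_openCell n e
        -- The frontier meets only finitely many cells, so unions of their closed cells are closed.
        have hcl : ∀ P : (Σ k, cell C k) → Prop,
            IsClosed (⋃ (k : ℕ) (_ : k < n) (j : cell C k) (_ : j ∈ I k ∧ P ⟨k, j⟩),
              closedCell k j) := by
          intro P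
          refine (Set.finite_lt_nat n).isClosed_biUnion fun k _ => ?_
          refine Set.Finite.isClosed_biUnion (s := {j | j ∈ I k ∧ P ⟨k, j⟩}) ?_
            fun j _ => isClosed_closedCell
          exact (I k).finite_toSet.subset fun j hj => hj.1
        have hmem : ∀ (P : (Σ k, cell C k) → Prop) {z : X} {k : ℕ} {j : cell C k},
            z ∈ cellFrontier n e → z ∈ openCell k j → P ⟨k, j⟩ →
            z ∈ ⋃ (k : ℕ) (_ : k < n) (j : cell C k) (_ : j ∈ I k ∧ P ⟨k, j⟩),
              closedCell k j := by
          intro P z k j hz hj hP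
          have h := hI hz
          simp only [mem_iUnion] at h
          obtain ⟨k', hk', j', hj', h⟩ := h
          cases sigma_eq_of_mem_openCell hj h
          simp only [mem_iUnion]
          exact ⟨k, hk', j, ⟨hj', hP⟩, openCell_subset_closedCell _ _ hj⟩
        obtain ⟨z, hz, hz₁, hz₂⟩ := isPreconnected_closed_iff.1
          (isPreconnected_cellFrontier (by omega) e) _ _
          (hcl fun j => Coloured K j.1 j.2) (hcl fun j => ¬ Coloured K j.1 j.2)
          (fun z hz => by
            obtain ⟨k, hk, j, hj⟩ := exists_lt_mem_openCell hz
            by_cases h : Coloured K k j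
            · exact Or.inl (hmem (fun j => Coloured K j.1 j.2) hz hj h)
            · exact Or.inr (hmem (fun j => ¬ Coloured K j.1 j.2) hz hj h))
          ⟨y, hy, hmem (fun j => Coloured K j.1 j.2) hy hy' h₁⟩
          ⟨x, hx, hmem (fun j => ¬ Coloured K j.1 j.2) hx hx' hcol⟩
        obtain ⟨k, hk, j, hj⟩ := exists_lt_mem_openCell hz
        simp only [mem_iUnion] at hz₁ hz₂
        obtain ⟨k₁, hk₁, j₁, ⟨-, hc₁⟩, hz₁⟩ := hz₁
        obtain ⟨k₂, hk₂, j₂, ⟨-, hc₂⟩, hz₂⟩ := hz₂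
        exact hc₂ ((ih k₂ hk₂ j₂ k j z hz₂ hj).1 ((ih k₁ hk₁ j₁ k j z hz₁ hj).2 hc₁))

/-- If a set of vertices of a CW complex contains with one endpoint of a `1`-cell also the other
one, then it contains all or none of the vertices in a given preconnected set. -/
theorem mem_of_isPreconnected {K : Set (cell C 0)}
    (hK : ∀ (e : cell C 1) (v w : cell C 0), map 0 v ![] ∈ cellFrontier 1 e →
      map 0 w ![] ∈ cellFrontier 1 e → v ∈ K → w ∈ K)
    {Z : Set X} (hZ : IsPreconnected Z) (hZC : Z ⊆ C) {v w : cell C 0} (hv : map 0 v ![] ∈ Z)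
    (hw : map 0 w ![] ∈ Z) (hvK : v ∈ K) : w ∈ K := by
  by_contra hwK
  have hcov : ∀ {x : X}, x ∈ C → ∃ (n : ℕ) (e : cell C n), x ∈ openCell n e := by
    intro x hx
    rw [← CWComplex.iUnion_openCell_eq_complex (C := C)] at hx
    simpa only [mem_iUnion] using hx
  have hconst : ∀ {n m : ℕ} {i : cell C n} {j : cell C m} {x : X}, x ∈ closedCell n i →
      x ∈ closedCell m j → (Coloured K n i ↔ Coloured K m j) := by
    intro n m i j x hi hj
    obtain ⟨k, e, he⟩ := hcov (closedCell_subset_complex n i hi)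
    rw [← coloured_iff_of_mem hK n i k e x hi he, ← coloured_iff_of_mem hK m j k e x hj he]
  -- Closedness is tested on each closed cell. By `hconst`, intersecting closed cells have equal
  -- colour, so the union contains a given closed cell or misses it.
  have hcl : ∀ P : Prop → Prop,
      IsClosed (⋃ (n : ℕ) (e : cell C n) (_ : P (Coloured K n e)), closedCell n e) := by
    intro P
    rw [CWComplex.closed C]
    · intro n j
      by_cases h : P (Coloured K n j)
      · rw [inter_eq_right.2]
        · exact isClosed_closedCell
        · intro x hx
          simp only [mem_iUnion]
          exact ⟨n, j, h, hx⟩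
      · convert isClosed_empty
        rw [eq_empty_iff_forall_notMem]
        rintro x ⟨hx, hxj⟩
        simp only [mem_iUnion] at hx
        obtain ⟨k, e, he, hx⟩ := hx
        rw [propext (hconst hx hxj)] at he
        exact h he
    · exact iUnion_subset fun n => iUnion_subset fun e => iUnion_subset fun _ =>
        closedCell_subset_complex n e
  have hvert : ∀ v : cell C 0, map 0 v ![] ∈ closedCell 0 v := by
    intro v
    rw [closedCell_zero_eq_singleton]
    rfl
  obtain ⟨z, -, hz₁, hz₂⟩ := isPreconnected_closed_iff.1 hZ _ _ (hcl id) (hcl Not)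
    (fun z hz => by
      obtain ⟨n, e, he⟩ := hcov (hZC hz)
      simp only [mem_union, mem_iUnion]
      by_cases h : Coloured K n e
      · exact Or.inl ⟨n, e, h, openCell_subset_closedCell _ _ he⟩
      · exact Or.inr ⟨n, e, h, openCell_subset_closedCell _ _ he⟩)
    ⟨_, hv, by
      simp only [mem_iUnion]
      exact ⟨0, v, coloured_zero_iff.2 hvK, hvert v⟩⟩
    ⟨_, hw, by
      simp only [mem_iUnion]
      exact ⟨0, w, fun h => hwK (coloured_zero_iff.1 h), hvert w⟩⟩
  simp only [mem_iUnion] at hz₁ hz₂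
  obtain ⟨n, e, he, hz₁⟩ := hz₁
  obtain ⟨m, e', he', hz₂⟩ := hz₂
  exact he' ((hconst hz₁ hz₂).1 he)

end CWComplex

/-! ### Distances in the Cayley tree and horoballs -/

section Horoball

variable {M : Type*} [MetricSpace M]

theorem mem_horoball {τ : GeodesicRay M} {k : ℝ} {x : M} :
    x ∈ horoball τ k ↔ ∃ l : NNReal, k ≤ l ∧ dist x (τ.toFun l) ≤ l - k := by
  simp [horoball]

theorem mem_horoball_of_dist_le {τ : GeodesicRay M} {k r : ℝ} {x y : M} (hx : x ∈ horoball τ k)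
    (h : dist x y ≤ r) : y ∈ horoball τ (k - r) := by
  obtain ⟨l, hl, hd⟩ := mem_horoball.1 hx
  have h0 : 0 ≤ dist x y := dist_nonneg
  refine mem_horoball.2 ⟨l, by linarith, ?_⟩
  have := dist_triangle_left y (τ.toFun l) x
  linarith

theorem horoball_antitone (τ : GeodesicRay M) : Antitone (horoball τ) := by
  intro s t h x hx
  have := mem_horoball_of_dist_le hx (y := x) (r := t - s) (by simpa using h)
  simpa using this

theorem dist_le_of_le {τ : GeodesicRay M} {k : ℝ} {x : M} {l l' : NNReal}
    (h : dist x (τ.toFun l) ≤ l - k) (hl : l ≤ l') : dist x (τ.toFun l') ≤ l' - k := by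
  have h1 := dist_triangle x (τ.toFun l) (τ.toFun l')
  have h3 : (l : ℝ) ≤ l' := hl
  have h2 : dist (τ.toFun l) (τ.toFun l') = l' - l := by
    rw [τ.isometry.dist_eq, NNReal.dist_eq, abs_sub_comm, abs_of_nonneg (by linarith)]
  linarith

/-- Two points of a horoball lie in a common one of the balls that exhaust it. -/
theorem exists_common_ball {τ : GeodesicRay M} {k : ℝ} {x y : M} (hx : x ∈ horoball τ k)
    (hy : y ∈ horoball τ k) :
    ∃ l : NNReal, k ≤ l ∧ dist x (τ.toFun l) ≤ l - k ∧ dist y (τ.toFun l) ≤ l - k := by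
  obtain ⟨l, hl, hd⟩ := mem_horoball.1 hx
  obtain ⟨l', hl', hd'⟩ := mem_horoball.1 hy
  refine ⟨max l l', hl.trans (le_max_left l l'), dist_le_of_le hd (le_max_left l l'),
    dist_le_of_le hd' (le_max_right l l')⟩

theorem exists_mem_horoball (τ : GeodesicRay M) (x : M) : ∃ k : ℝ, x ∈ horoball τ k :=
  ⟨-dist x (τ.toFun 0), mem_horoball.2 ⟨0, by simp, by simp⟩⟩

/-- Membership in `Sigma1` only provides some ray in the asymptotic class; this transfers
information from that ray to the given one. -/
theorem exists_horoball_subset_of_endpoint_eq {τ σ : GeodesicRay M}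
    (h : τ.endpoint = σ.endpoint) : ∃ r : ℝ, ∀ k, horoball τ k ⊆ horoball σ (k - r) := by
  obtain ⟨r, hr⟩ : ∃ C : ℝ, ∀ l : NNReal, dist (τ.toFun l) (σ.toFun l) ≤ C := Quotient.exact h
  refine ⟨r, fun k x hx => ?_⟩
  obtain ⟨l, hl, hd⟩ := mem_horoball.1 hx
  have h0 : 0 ≤ dist (τ.toFun l) (σ.toFun l) := dist_nonneg
  have h1 := dist_triangle x (τ.toFun l) (σ.toFun l)
  have h2 := hr l
  exact mem_horoball.2 ⟨l, by linarith, by linarith⟩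

end Horoball

/-! ### Word metric and vertices of the Cayley tree. -/

section CayleyTreeVertices

variable {ι A : Type*} [Group A] (b : FreeGroupBasis ι A)

/-- From `a ≠ c`, one step along an edge leads closer to `c`. -/
theorem exists_wordDist_mul_le {a c : A} {n : ℕ} (h : wordDist b a c = n + 1) :
    ∃ i, wordDist b (a * b i) c ≤ n ∨ wordDist b (a * (b i)⁻¹) c ≤ n := by
  classical
  have hmk : FreeGroup.mk (b.repr (a⁻¹ * c)).toWord = b.repr (a⁻¹ * c) := FreeGroup.mk_toWord
  have hlen : (b.repr (a⁻¹ * c)).toWord.length = n + 1 := by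
    rw [← h, wordDist, FreeGroup.norm]
  obtain ⟨⟨i, ε⟩, L, hL⟩ := List.exists_cons_of_length_eq_add_one hlen
  rw [hL] at hmk hlen
  have hL' : L.length = n := by simpa using hlen
  have hle : ∀ u : A, b.repr (u⁻¹ * c) = FreeGroup.mk L → wordDist b u c ≤ n := by
    intro u hu
    rw [wordDist, hu, ← hL']
    convert FreeGroup.norm_mk_le
  refine ⟨i, ?_⟩
  cases ε with
  | true =>
    left
    refine hle _ ?_
    have h1 : FreeGroup.mk ((i, true) :: L) = FreeGroup.of i * FreeGroup.mk L := by
      rw [FreeGroup.of, FreeGroup.mul_mk]; rfl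
    rw [mul_inv_rev, mul_assoc, map_mul, ← hmk, h1, map_inv, FreeGroupBasis.repr_apply_coe]
    group
  | false =>
    right
    refine hle _ ?_
    have h1 : FreeGroup.mk ((i, false) :: L) = (FreeGroup.of i)⁻¹ * FreeGroup.mk L := by
      rw [FreeGroup.of, FreeGroup.inv_mk, FreeGroup.mul_mk]; rfl
    rw [mul_inv_rev, mul_assoc, map_mul, ← hmk, h1, inv_inv, FreeGroupBasis.repr_apply_coe]
    group

namespace CayleyTree

theorem vertexDist_vertex (a v : A) : (vertex b a).vertexDist v = wordDist b a v := by
  simp [vertexDist, vertex]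

theorem dist_vertex_vertex (a c : A) : dist (vertex b a) (vertex b c) = wordDist b a c := by
  rw [dist_def]
  simp only [vertexDist_vertex]
  refine le_antisymm (ciSup_le fun v => ?_) ?_
  · have h1 := wordDist_cast_triangle b a c v
    have h2 := wordDist_cast_triangle b c a v
    rw [wordDist_comm b c a] at h2
    rw [abs_le]
    constructor <;> linarith
  · have hb : BddAbove (Set.range fun v : A => |(wordDist b a v : ℝ) - wordDist b c v|) := by
      simpa only [vertexDist_vertex] using bddAbove_vertexDist (vertex b a) (vertex b c)
    have := le_ciSup hb c
    simpa [wordDist_self] using this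

variable {b} in
-- The points `τ(l)` of a ray need not be vertices; this allows them to be replaced by vertices at
-- the cost of `1`.
theorem exists_dist_vertex_le_one (x : CayleyTree b) : ∃ a, dist x (vertex b a) ≤ 1 := by
  obtain ⟨a, c, hac, hx⟩ := x.supported
  refine ⟨a, ?_⟩
  rw [dist_def]
  refine ciSup_le fun v => ?_
  rw [vertexDist_vertex]
  have h1 : (wordDist b a v : ℝ) = x.coord.sum fun _ m => m * (wordDist b a v : ℝ) := by
    have := x.sum_eq_one
    unfold Finsupp.sum at this ⊢
    rw [← Finset.sum_mul, this, one_mul]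
  rw [h1, ← x.sum_eq_one]
  unfold vertexDist Finsupp.sum
  rw [← Finset.sum_sub_distrib]
  refine (Finset.abs_sum_le_sum_abs _ _).trans (Finset.sum_le_sum fun w hw => ?_)
  rw [← mul_sub, abs_mul, abs_of_nonneg (x.nonneg w)]
  refine mul_le_of_le_one_right (x.nonneg w) ?_
  have hwa : wordDist b w a ≤ 1 := by
    have hw' : w = a ∨ w = c := by simpa using hx hw
    rcases hw' with rfl | rfl
    · simp [wordDist_self]
    · rcases hac with rfl | hac
      · simp [wordDist_self]
      · rw [wordDist_comm, wordDist_of_adj b hac]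
  have hwa' : (wordDist b w a : ℝ) ≤ 1 := by exact_mod_cast hwa
  have h2 := wordDist_cast_triangle b w a v
  have h3 := wordDist_cast_triangle b a w v
  rw [wordDist_comm b a w] at h3
  rw [abs_le]
  constructor <;> linarith

theorem action_vertex (g a : A) : action b g (vertex b a) = vertex b (g * a) := by
  ext w
  change Finsupp.equivMapDomain (Equiv.mulLeft g) (Finsupp.single a 1) w = _
  rw [Finsupp.equivMapDomain_single]
  rfl

end CayleyTree

end CayleyTreeVertices

/-! ### Cells and sublevel sets of control data -/

namespace ControlData

open Topology Topology.RelCWComplex Set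

variable {G M : Type*} [Group G] [MetricSpace M] {ρ : G →* (M ≃ᵢ M)} (𝒟 : ControlData ρ)

/-- The point of `X` given by a `0`-cell. -/
def vertexPoint (v : cell (univ : Set 𝒟.X) 0) : 𝒟.X := map 0 v ![]

variable {𝒟}

theorem closedCell_zero (v : cell (univ : Set 𝒟.X) 0) : closedCell 0 v = {𝒟.vertexPoint v} :=
  closedCell_zero_eq_singleton

theorem openCell_zero (v : cell (univ : Set 𝒟.X) 0) : openCell 0 v = {𝒟.vertexPoint v} :=
  openCell_zero_eq_singleton

theorem exists_smul_cell (g : G) (n : ℕ) (i : cell (univ : Set 𝒟.X) n) :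
    ∃ j : cell (univ : Set 𝒟.X) n, (fun x : 𝒟.X => g • x) '' openCell n i = openCell n j ∧
      (fun x : 𝒟.X => g • x) '' closedCell n i = closedCell n j := by
  obtain ⟨j, hj⟩ := 𝒟.cellular g n i
  refine ⟨j, hj, ?_⟩
  rw [← closure_openCell_eq_closedCell, ← closure_openCell_eq_closedCell, ← hj]
  exact (Homeomorph.smul g).image_closure _

theorem exists_smul_vertexPoint (g : G) (v : cell (univ : Set 𝒟.X) 0) :
    ∃ w, 𝒟.vertexPoint w = g • 𝒟.vertexPoint v := by
  obtain ⟨w, hw, -⟩ := exists_smul_cell g 0 v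
  rw [openCell_zero, openCell_zero, image_singleton, singleton_eq_singleton_iff] at hw
  exact ⟨w, hw.symm⟩

theorem eq_one_of_smul_vertexPoint {g : G} {v : cell (univ : Set 𝒟.X) 0}
    (h : g • 𝒟.vertexPoint v = 𝒟.vertexPoint v) : g = 1 := by
  refine 𝒟.free g 0 v ?_
  rw [openCell_zero, image_singleton, h]

theorem closedCell_subset_skeleton_one {n : ℕ} (hn : n ≤ 1) (e : cell (univ : Set 𝒟.X) n) :
    closedCell n e ⊆ (skeleton (univ : Set 𝒟.X) 1 : Set 𝒟.X) :=
  (closedCell_subset_skeleton n e).trans (skeleton_mono (by exact_mod_cast hn))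

theorem vertexPoint_mem_skeleton (v : cell (univ : Set 𝒟.X) 0) :
    𝒟.vertexPoint v ∈ (skeleton (univ : Set 𝒟.X) 1 : Set 𝒟.X) :=
  closedCell_subset_skeleton_one zero_le_one v (by rw [closedCell_zero]; rfl)

/-- In a free action that permutes the vertices, the vertices can be labelled equivariantly by
group elements. -/
theorem exists_equivariant_label (𝒟 : ControlData ρ) :
    ∃ γ : 𝒟.X → G, ∀ (g : G) (v : cell (univ : Set 𝒟.X) 0),
      γ (g • 𝒟.vertexPoint v) = g * γ (𝒟.vertexPoint v) := by
  have h : ∀ x : 𝒟.X, ∃ g : G, g • (Quotient.out (Quotient.mk (MulAction.orbitRel G 𝒟.X) x)) = x :=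
    fun x => (MulAction.orbitRel G 𝒟.X).symm (Quotient.mk_out (s := MulAction.orbitRel G 𝒟.X) x)
  choose γ hγ using h
  refine ⟨γ, fun g v => ?_⟩
  set x := 𝒟.vertexPoint v
  have hq : Quotient.mk (MulAction.orbitRel G 𝒟.X) (g • x) =
      Quotient.mk (MulAction.orbitRel G 𝒟.X) x := Quotient.sound ⟨g, rfl⟩
  have h1 := hγ (g • x)
  rw [hq] at h1
  have h2 := hγ x
  set r := Quotient.out (Quotient.mk (MulAction.orbitRel G 𝒟.X) x)
  generalize γ (g • x) = u at h1 ⊢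
  -- Both labels refer to the same orbit representative `r`, so freeness at `x` determines `u`.
  have h3 : (γ x * u⁻¹ * g) • x = x := by
    rw [mul_smul, ← h1, mul_smul, inv_smul_smul, h2]
  have h4 := eq_one_of_smul_vertexPoint h3
  rw [mul_assoc, mul_eq_one_iff_eq_inv, mul_inv_rev, inv_inv] at h4
  rw [h4, mul_inv_cancel_left]

/-- A closed cell of dimension at most `1` is itself a subcomplex, because its frontier consists of
`0`-cells. -/
theorem closedCell_subset_sublevel {τ : GeodesicRay M} {t : ℝ} {n : ℕ} (hn : n ≤ 1)
    {e : cell (univ : Set 𝒟.X) n} (h : closedCell n e ⊆ 𝒟.h ⁻¹' horoball τ t) :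
    closedCell n e ⊆ 𝒟.sublevel τ t := by
  intro x hx
  refine ⟨CWComplex.Subcomplex.mk' univ (closedCell n e)
    (fun m => {j | openCell m j ⊆ closedCell n e}) ?_ ?_,
    closedCell_subset_skeleton_one hn e, h, hx⟩
  · rintro m ⟨j, hj⟩
    rw [← closure_openCell_eq_closedCell]
    exact closure_minimal hj isClosed_closedCell
  · refine subset_antisymm (iUnion_subset fun m => iUnion_subset fun j => j.2) fun y hy => ?_
    simp only [mem_iUnion]
    have hy' := hy
    rw [← cellFrontier_union_openCell_eq_closedCell] at hy'
    rcases hy' with hy' | hy'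
    · obtain ⟨m, hm, j, hj⟩ := exists_lt_mem_openCell hy'
      obtain rfl : m = 0 := by omega
      refine ⟨0, ⟨j, ?_⟩, hj⟩
      rw [openCell_zero, mem_singleton_iff] at hj
      change openCell 0 j ⊆ _
      rw [openCell_zero, ← hj]
      exact singleton_subset_iff.2 hy
    · exact ⟨n, ⟨e, openCell_subset_closedCell n e⟩, hy'⟩

theorem exists_cell_of_mem_sublevel {τ : GeodesicRay M} {t : ℝ} {x : 𝒟.X}
    (hx : x ∈ 𝒟.sublevel τ t) : ∃ n ≤ 1, ∃ e : cell (univ : Set 𝒟.X) n, x ∈ openCell n e ∧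
      closedCell n e ⊆ 𝒟.h ⁻¹' horoball τ t := by
  obtain ⟨E, hE, hEh, hx⟩ := hx
  obtain ⟨m, hm, i, hi⟩ := CWComplex.mem_skeleton_iff.1 (SetLike.mem_coe.1 (hE hx))
  rw [← CWComplex.Subcomplex.union] at hx
  simp only [mem_iUnion] at hx
  obtain ⟨n, ⟨e, he⟩, hxe⟩ := hx
  cases sigma_eq_of_mem_openCell hi hxe
  exact ⟨_, by exact_mod_cast hm, _, hi, (E.closedCell_subset_of_mem he).trans hEh⟩

theorem sublevel_antitone (𝒟 : ControlData ρ) (τ : GeodesicRay M) : Antitone (𝒟.sublevel τ) := by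
  rintro s t h x ⟨E, hE, hEh, hx⟩
  exact ⟨E, hE, hEh.trans (preimage_mono (horoball_antitone τ h)), hx⟩

/-- The sublevel set as a subcomplex. -/
def sublevelSubcomplex (𝒟 : ControlData ρ) (τ : GeodesicRay M) (t : ℝ) :
    Subcomplex (univ : Set 𝒟.X) :=
  CWComplex.Subcomplex.mk' univ (𝒟.sublevel τ t)
    (fun n => {e | n ≤ 1 ∧ closedCell n e ⊆ 𝒟.h ⁻¹' horoball τ t})
    (fun _ e => closedCell_subset_sublevel e.2.1 e.2.2)
    (by
      refine subset_antisymm (iUnion_subset fun n => iUnion_subset fun e =>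
        (openCell_subset_closedCell _ _).trans (closedCell_subset_sublevel e.2.1 e.2.2))
        fun x hx => ?_
      obtain ⟨n, hn, e, hxe, he⟩ := exists_cell_of_mem_sublevel hx
      simp only [mem_iUnion]
      exact ⟨n, ⟨e, hn, he⟩, hxe⟩)

theorem vertexPoint_mem_sublevel_iff {τ : GeodesicRay M} {t : ℝ}
    {v : cell (univ : Set 𝒟.X) 0} :
    𝒟.vertexPoint v ∈ 𝒟.sublevel τ t ↔ 𝒟.h (𝒟.vertexPoint v) ∈ horoball τ t := by
  refine ⟨fun ⟨E, _, hEh, hx⟩ => hEh hx, fun h => ?_⟩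
  refine closedCell_subset_sublevel zero_le_one (e := v) ?_ ?_ <;> rw [closedCell_zero]
  · exact singleton_subset_iff.2 h
  · rfl

/-- Every point of a sublevel set can be joined to a vertex. -/
theorem exists_joinedIn_vertexPoint {τ : GeodesicRay M} {t : ℝ} {x : 𝒟.X}
    (hx : x ∈ 𝒟.sublevel τ t) : ∃ v, JoinedIn (𝒟.sublevel τ t) x (𝒟.vertexPoint v) := by
  obtain ⟨n, hn, e, hxe, he⟩ := exists_cell_of_mem_sublevel hx
  obtain ⟨v, hv⟩ : ∃ v, 𝒟.vertexPoint v ∈ closedCell n e := by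
    by_cases h0 : n = 0
    · subst h0
      exact ⟨e, by rw [closedCell_zero]; rfl⟩
    · obtain ⟨y, hy⟩ := nonempty_cellFrontier h0 e
      obtain ⟨m, hm, j, hj⟩ := exists_lt_mem_openCell hy
      obtain rfl : m = 0 := by omega
      rw [openCell_zero, mem_singleton_iff] at hj
      exact ⟨j, hj ▸ cellFrontier_subset_closedCell n e hy⟩
  exact ⟨v, ((isPathConnected_closedCell n e).joinedIn x (openCell_subset_closedCell n e hxe) _
    hv).mono (closedCell_subset_sublevel hn he)⟩

theorem nonempty_vertex (𝒟 : ControlData ρ) : Nonempty (cell (univ : Set 𝒟.X) 0) := by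
  obtain ⟨x⟩ : Nonempty 𝒟.X := inferInstance
  have hx : x ∈ (univ : Set 𝒟.X) := mem_univ x
  rw [← CWComplex.iUnion_openCell_eq_complex (C := (univ : Set 𝒟.X))] at hx
  simp only [mem_iUnion] at hx
  obtain ⟨n, e, -⟩ := hx
  exact nonempty_vertex_of_cell n e

theorem isBounded_image_closedCell {n : ℕ} (hn : n ≤ 1) (e : cell (univ : Set 𝒟.X) n) :
    Bornology.IsBounded (𝒟.h '' closedCell n e) :=
  (isCompact_closedCell.image_of_continuousOn
    (𝒟.continuousOn_h.mono (closedCell_subset_skeleton_one hn e))).isBounded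

/-- `x` and `y` are translated by every `g ∈ G` to points that can be joined at a bounded distance
of the translate of the base point `o`, as measured by the horoballs about `τ(∞)`. -/
def Near (𝒟 : ControlData ρ) (τ : GeodesicRay M) (o : M) (x y : 𝒟.X) : Prop :=
  ∃ D : ℝ, ∀ (g : G) (s : ℝ), ρ g o ∈ horoball τ s →
    JoinedIn (𝒟.sublevel τ (s - D)) (g • x) (g • y)

variable {τ : GeodesicRay M} {o : M}

theorem Near.trans {x y z : 𝒟.X} (h : 𝒟.Near τ o x y) (h' : 𝒟.Near τ o y z) :
    𝒟.Near τ o x z := by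
  obtain ⟨D, hD⟩ := h
  obtain ⟨D', hD'⟩ := h'
  refine ⟨max D D', fun g s hg => ((hD g s hg).mono ?_).trans ((hD' g s hg).mono ?_)⟩
  · exact 𝒟.sublevel_antitone τ (sub_le_sub_left (le_max_left _ _) s)
  · exact 𝒟.sublevel_antitone τ (sub_le_sub_left (le_max_right _ _) s)

/-- The control image of the cell is bounded, and by equivariance its translate by `g` stays equally
close to `ρ g o`. -/
theorem near_of_mem_closedCell {n : ℕ} (hn : n ≤ 1) {e : cell (univ : Set 𝒟.X) n} {x y : 𝒟.X}
    (hx : x ∈ closedCell n e) (hy : y ∈ closedCell n e) : 𝒟.Near τ o x y := by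
  obtain ⟨D, hD⟩ := (isBounded_image_closedCell hn e).subset_closedBall o
  refine ⟨D, fun g s hg => ?_⟩
  obtain ⟨e', -, he'⟩ := exists_smul_cell g n e
  refine ((isPathConnected_closedCell n e').joinedIn _ (he' ▸ mem_image_of_mem _ hx) _
    (he' ▸ mem_image_of_mem _ hy)).mono (closedCell_subset_sublevel hn ?_)
  rw [← he']
  rintro _ ⟨z, hz, rfl⟩
  refine mem_horoball_of_dist_le hg ?_
  rw [𝒟.equivariant_h g z (closedCell_subset_skeleton_one hn e hz), (ρ g).dist_eq, dist_comm]
  exact hD (mem_image_of_mem _ hz)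

/-- The vertices near `v` are closed under adjacency, and `X` is connected, being contractible. -/
theorem near_vertexPoint (v w : cell (univ : Set 𝒟.X) 0) :
    𝒟.Near τ o (𝒟.vertexPoint v) (𝒟.vertexPoint w) := by
  refine mem_of_isPreconnected (C := (univ : Set 𝒟.X))
    (K := {w | 𝒟.Near τ o (𝒟.vertexPoint v) (𝒟.vertexPoint w)}) (v := v) (Z := univ) ?_
    isPreconnected_univ subset_rfl (mem_univ _) (mem_univ _) ?_
  · intro e u u' hu hu' h
    exact Near.trans h (near_of_mem_closedCell le_rfl (cellFrontier_subset_closedCell _ _ hu)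
      (cellFrontier_subset_closedCell _ _ hu'))
  · exact near_of_mem_closedCell zero_le_one (e := v) (by rw [closedCell_zero]; rfl)
      (by rw [closedCell_zero]; rfl)

/-- The bound for joining a vertex to finitely many other ones can be chosen uniformly. -/
theorem exists_uniform_near (v : cell (univ : Set 𝒟.X) 0) {Q : Set (cell (univ : Set 𝒟.X) 0)}
    (hQ : Q.Finite) : ∃ D : ℝ, ∀ w ∈ Q, ∀ (g : G) (s : ℝ), ρ g o ∈ horoball τ s →
      JoinedIn (𝒟.sublevel τ (s - D)) (g • 𝒟.vertexPoint v) (g • 𝒟.vertexPoint w) := by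
  choose D hD using fun w => near_vertexPoint (𝒟 := 𝒟) (τ := τ) (o := o) v w
  obtain ⟨D', hD'⟩ := (hQ.image D).bddAbove
  exact ⟨D', fun w hw g s hg => (hD w g s hg).mono
    (𝒟.sublevel_antitone τ (sub_le_sub_left (hD' (mem_image_of_mem D hw)) s))⟩

end ControlData

/-! ### The sufficient condition -/

section SemidirectProduct

open Topology Topology.RelCWComplex CayleyTree ControlData

variable {ι A B : Type*} [Group A] [Group B] {b : FreeGroupBasis ι A} {φ : A →* MulAut B}

theorem semidirectAction_vertex (g : B ⋊[φ] A) (a : A) :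
    semidirectAction b φ g (vertex b a) = vertex b (g.right * a) :=
  action_vertex b g.right a

theorem semidirectAction_inl (x : B) (y : CayleyTree b) :
    semidirectAction b φ (SemidirectProduct.inl x) y = y := by
  simp [semidirectAction]

open SemidirectProduct in
/-- Let `R s` be equivalence relations on `G = B ⋊ A` such that right multiplication by a basis
element of `A` or by an element of `S` leads from `g` to an equivalent element, provided that the
vertex of `g` lies in the horoball of `s`. If `S` generates `B` over the vertices of a horoball
then all elements over a slightly larger horoball are equivalent. -/
theorem rel_of_generatesOver {τ : GeodesicRay (CayleyTree b)} {R : B ⋊[φ] A → B ⋊[φ] A → Prop}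
    (hR : Equivalence R) {S : Set B} {s : ℝ}
    (hb : ∀ (i : ι) (g : B ⋊[φ] A), vertex b g.right ∈ horoball τ (s - 2) → R g (g * inr (b i)))
    (hS : ∀ x ∈ S, ∀ g : B ⋊[φ] A, vertex b g.right ∈ horoball τ (s - 2) → R g (g * inl x))
    {A' : Set A} (hA' : ∀ a ∈ A', vertex b a ∈ horoball τ s) (hgen : GeneratesOver φ S A')
    (g g' : B ⋊[φ] A) (hg : vertex b g.right ∈ horoball τ s)
    (hg' : vertex b g'.right ∈ horoball τ s) : R g g' := by
  -- Inside sheet `γ`, follow a geodesic from `a` to `c`, a vertex near `τ(l)`. Its vertices are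
  -- within `l - s + 1` of `c`, hence within `l - (s - 2)` of `τ(l)`; this is the source of the loss
  -- `2`.
  have step : ∀ (l : NNReal) (c : A), s ≤ l → dist (τ.toFun l) (vertex b c) ≤ 1 →
      ∀ (n : ℕ) (γ : B) (a : A), wordDist b a c ≤ n → (n : ℝ) ≤ l - s + 1 →
      R (inl γ * inr a) (inl γ * inr c) := by
    intro l c hl hc n
    have hmem : ∀ a, (wordDist b a c : ℝ) ≤ l - s + 1 → vertex b a ∈ horoball τ (s - 2) := by
      intro a ha
      have h1 := dist_triangle_right (vertex b a) (τ.toFun l) (vertex b c)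
      rw [dist_vertex_vertex] at h1
      exact mem_horoball.2 ⟨l, by linarith, by linarith⟩
    have hmem' : ∀ (a : A) (n : ℕ), wordDist b a c ≤ n → (n : ℝ) ≤ l - s + 1 →
        vertex b a ∈ horoball τ (s - 2) := fun a n h h' =>
      hmem a (le_trans (by exact_mod_cast h) h')
    induction n with
    | zero =>
      intro γ a h _
      rw [wordDist_eq_zero b (Nat.le_zero.1 h)]
      exact hR.refl _
    | succ n ih =>
      intro γ a h hn
      have hn' : (n : ℝ) ≤ l - s + 1 := by
        push_cast at hn
        linarith
      rcases Nat.lt_or_ge (wordDist b a c) (n + 1) with hlt | hge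
      · exact ih γ a (Nat.lt_succ_iff.1 hlt) hn'
      · obtain ⟨i, hi | hi⟩ := exists_wordDist_mul_le b (le_antisymm h hge)
        · refine hR.trans ?_ (ih γ _ hi hn')
          have := hb i (inl γ * inr a) (by simpa using hmem' a _ h hn)
          rwa [mul_assoc, ← map_mul] at this
        · refine hR.trans (hR.symm ?_) (ih γ _ hi hn')
          -- A step along an inverse generator is the reverse of a step along `b i` starting at the
          -- new vertex, which also lies in the horoball.
          have := hb i (inl γ * inr (a * (b i)⁻¹)) (by simpa using hmem' _ _ hi hn')
          rwa [mul_assoc, ← map_mul, inv_mul_cancel_right] at this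
  have conn : ∀ (γ : B) (a a' : A), vertex b a ∈ horoball τ s → vertex b a' ∈ horoball τ s →
      R (inl γ * inr a) (inl γ * inr a') := by
    intro γ a a' ha ha'
    obtain ⟨l, hl, hd, hd'⟩ := exists_common_ball ha ha'
    obtain ⟨c, hc⟩ := exists_dist_vertex_le_one (τ.toFun l)
    have hle : ∀ a, dist (vertex b a) (τ.toFun l) ≤ l - s →
        (wordDist b a c : ℝ) ≤ l - s + 1 := by
      intro a ha
      rw [← dist_vertex_vertex]
      linarith [dist_triangle (vertex b a) (τ.toFun l) (vertex b c)]
    exact hR.trans (step l c hl hc _ γ a le_rfl (hle a hd))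
      (hR.symm (step l c hl hc _ γ a' le_rfl (hle a' hd')))
  -- To multiply by `φ a y`, move inside the sheet to `a`, apply `inr a * inl y = inl (φ a y) * inr
  -- a`, and move back in the new sheet. The sheet `γ` stays universally quantified so that the
  -- closure induction can treat products and inverses.
  have shift : ∀ β γ : B, R (inl γ * inr g.right) (inl (γ * β) * inr g.right) := by
    intro β
    have hβ : β ∈ Subgroup.closure {x : B | ∃ s ∈ S, ∃ a ∈ A', x = φ a s} := by
      rw [show Subgroup.closure _ = ⊤ from hgen]
      trivial
    induction hβ using Subgroup.closure_induction with
    | mem x hx =>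
      obtain ⟨y, hy, a, ha, rfl⟩ := hx
      intro γ
      refine hR.trans (conn γ _ a hg (hA' a ha)) (hR.trans ?_ (conn _ a _ (hA' a ha) hg))
      have := hS y hy (inl γ * inr a)
        (by simpa using horoball_antitone τ (by linarith : s - 2 ≤ s) (hA' a ha))
      convert this using 1
      rw [map_mul, inl_aut]
      simp [mul_assoc]
    | one =>
      intro γ
      rw [mul_one]
      exact hR.refl _
    | mul x y _ _ hx hy =>
      intro γ
      refine hR.trans (hx γ) ?_
      rw [← mul_assoc]
      exact hy (γ * x)
    | inv x _ hx =>
      intro γ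
      have := hx (γ * x⁻¹)
      rw [inv_mul_cancel_right] at this
      exact hR.symm this
  have h1 := shift (g.left⁻¹ * g'.left) g.left
  rw [mul_inv_cancel_left, inl_left_mul_inr_right] at h1
  have h2 := conn g'.left _ _ hg hg'
  rw [inl_left_mul_inr_right] at h2
  exact hR.trans h1 h2

variable [Finite ι]

theorem isControlledConnected_of_generatesOver (𝒟 : ControlData (semidirectAction b φ))
    (τ : GeodesicRay (CayleyTree b)) {S : Set B} (hSf : S.Finite)
    (hS : ∀ k : ℤ, 0 ≤ k → GeneratesOver φ S (horoballVertices b τ k)) :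
    𝒟.IsControlledConnected τ := by
  obtain ⟨v₀⟩ := 𝒟.nonempty_vertex
  obtain ⟨F, hF, hForb⟩ := 𝒟.cocompact 0 zero_le_one
  choose w hw using fun g : B ⋊[φ] A => exists_smul_vertexPoint g v₀
  obtain ⟨D, hD⟩ := exists_uniform_near (τ := τ) (o := vertex b 1) v₀
    ((hF.union (Set.finite_range fun i => w (SemidirectProduct.inr (b i)))).union
      (hSf.image fun x => w (SemidirectProduct.inl x)))
  simp only [semidirectAction_vertex, mul_one] at hD
  obtain ⟨D', hD'⟩ := (hF.image fun v => dist (𝒟.h (𝒟.vertexPoint v)) (vertex b 1)).bddAbove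
  have hD0 : ∀ v ∈ F, ∀ (g : B ⋊[φ] A) (t : ℝ), 𝒟.h (g • 𝒟.vertexPoint v) ∈ horoball τ t →
      vertex b g.right ∈ horoball τ (t - max D' 0) := by
    intro v hv g t h
    refine mem_horoball_of_dist_le h ?_
    have h1 := semidirectAction_vertex (b := b) g 1
    rw [mul_one] at h1
    rw [𝒟.equivariant_h g _ (vertexPoint_mem_skeleton v), ← h1, IsometryEquiv.dist_eq]
    exact (hD' (Set.mem_image_of_mem _ hv)).trans (le_max_left _ _)
  -- `D'` accounts for passing from a vertex of `X` to a group element, `2` for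
  -- `rel_of_generatesOver`, and `D` for the paths realising single moves.
  refine ⟨fun _ => max D' 0 + 2 + max D 0, fun _ => by positivity,
    Filter.tendsto_atTop_add_const_right _ _ Filter.tendsto_id, fun t x hx y hy => ?_⟩
  set s := t - max D' 0
  have hL : t - (max D' 0 + 2 + max D 0) = s - 2 - max D 0 := by ring
  rw [hL]
  have hjoin : ∀ u ∈ (F ∪ Set.range fun i => w (SemidirectProduct.inr (b i))) ∪
      (fun x => w (SemidirectProduct.inl x)) '' S, ∀ g : B ⋊[φ] A,
      vertex b g.right ∈ horoball τ (s - 2) →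
      JoinedIn (𝒟.sublevel τ (s - 2 - max D 0)) (g • 𝒟.vertexPoint v₀)
        (g • 𝒟.vertexPoint u) := fun u hu g hg =>
    (hD u hu g _ hg).mono (𝒟.sublevel_antitone τ (sub_le_sub_left (le_max_left _ _) _))
  have orbit : ∀ x ∈ 𝒟.sublevel τ t, ∃ g : B ⋊[φ] A, vertex b g.right ∈ horoball τ s ∧
      JoinedIn (𝒟.sublevel τ (s - 2 - max D 0)) x (g • 𝒟.vertexPoint v₀) := by
    intro x hx
    obtain ⟨v, hv⟩ := exists_joinedIn_vertexPoint hx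
    obtain ⟨u, hu, g, hg⟩ := hForb v
    rw [openCell_zero, openCell_zero, Set.image_singleton, Set.singleton_eq_singleton_iff] at hg
    have h1 := vertexPoint_mem_sublevel_iff.1 hv.target_mem
    rw [← hg] at h1 hv
    have h2 := hD0 u hu g t h1
    refine ⟨g, h2, (hv.mono (𝒟.sublevel_antitone τ ?_)).trans
      (hjoin u (by simp [hu]) g (horoball_antitone τ (by linarith : s - 2 ≤ s) h2)).symm⟩
    linarith [le_max_right D' 0, le_max_right D 0]
  obtain ⟨g, hg, hxg⟩ := orbit x hx
  obtain ⟨g', hg', hyg⟩ := orbit y hy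
  -- Equality is added because `JoinedIn` is reflexive only at points of the sublevel set.
  have hR : Equivalence fun g g' : B ⋊[φ] A => g = g' ∨
      JoinedIn (𝒟.sublevel τ (s - 2 - max D 0)) (g • 𝒟.vertexPoint v₀)
        (g' • 𝒟.vertexPoint v₀) := by
    refine ⟨fun g => Or.inl rfl, ?_, ?_⟩
    · rintro g g' (h | h)
      · exact Or.inl h.symm
      · exact Or.inr h.symm
    · rintro g g' g'' (rfl | h) (rfl | h')
      · exact Or.inl rfl
      · exact Or.inr h'
      · exact Or.inr h
      · exact Or.inr (h.trans h')
  have hfinal := rel_of_generatesOver hR (S := S) (s := s) (τ := τ)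
    (fun i g hg => by
      have := hjoin (w (SemidirectProduct.inr (b i))) (by simp) g hg
      rw [hw, ← mul_smul] at this
      exact Or.inr this)
    (fun x hx g hg => by
      have := hjoin (w (SemidirectProduct.inl x)) (Or.inr (Set.mem_image_of_mem _ hx)) g hg
      rw [hw, ← mul_smul] at this
      exact Or.inr this)
    -- The index must be nonnegative for `hS` and at least `s` for the horoball of `s` to contain
    -- these vertices.
    (A' := horoballVertices b τ (max 0 ⌈s⌉))
    (fun a ha => horoball_antitone τ ((Int.le_ceil s).trans
      (by exact_mod_cast le_max_right 0 ⌈s⌉)) ha)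
    (hS _ (le_max_left _ _)) g g' hg hg'
  rcases hfinal with rfl | h
  · exact hxg.trans hyg.symm
  · exact (hxg.trans h).trans hyg.symm

end SemidirectProduct

/-! ### The necessary condition -/

section Necessary

open Topology Topology.RelCWComplex CayleyTree ControlData

variable {ι A B : Type*} [Group A] [Group B] {b : FreeGroupBasis ι A} {φ : A →* MulAut B}

theorem FinitelyGeneratedOver.mono {A' A'' : Set A} (h : FinitelyGeneratedOver φ A')
    (hA : A' ⊆ A'') : FinitelyGeneratedOver φ A'' := by
  obtain ⟨S, hS, hgen⟩ := h
  refine ⟨S, hS, top_le_iff.1 (le_trans (le_of_eq hgen.symm) (Subgroup.closure_mono ?_))⟩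
  rintro x ⟨s, hs, a, ha, rfl⟩
  exact ⟨s, hs, a, hA ha, rfl⟩

/-- A single level `t`, low enough to include `v₀`, suffices. The generators are the differences of
the `B`-labels of the endpoints of the edges in `F`; translating such an edge by `g` applies `φ
g.right` to its difference. -/
theorem finitelyGeneratedOver_of_isControlledConnected
    (𝒟 : ControlData (semidirectAction b φ)) (τ : GeodesicRay (CayleyTree b))
    (h : 𝒟.IsControlledConnected τ) :
    ∃ k : ℤ, FinitelyGeneratedOver φ (horoballVertices b τ k) := by
  obtain ⟨lag, -, -, hlag⟩ := h
  obtain ⟨v₀⟩ := 𝒟.nonempty_vertex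
  obtain ⟨γ, hγ⟩ := 𝒟.exists_equivariant_label
  obtain ⟨F, hF, hForb⟩ := 𝒟.cocompact 1 le_rfl
  obtain ⟨t, ht⟩ := exists_mem_horoball τ (𝒟.h (𝒟.vertexPoint v₀))
  have hfr : ∀ e : cell (Set.univ : Set 𝒟.X) 1, (cellFrontier 1 e).Finite := by
    intro e
    rw [cellFrontier_one_eq]
    exact (Set.toFinite _).image _
  obtain ⟨D, hD⟩ : ∃ D : ℝ, ∀ e ∈ F, ∀ x ∈ closedCell 1 e, dist (𝒟.h x) (vertex b 1) ≤ D := by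
    obtain ⟨D, hD⟩ := ((Bornology.isBounded_biUnion hF).2
      fun e _ => isBounded_image_closedCell le_rfl e).subset_closedBall (vertex b 1)
    exact ⟨D, fun e he x hx => hD (Set.mem_biUnion he (Set.mem_image_of_mem _ hx))⟩
  refine ⟨⌊t - lag t - D⌋,
    ⋃ e ∈ F, Set.image2 (fun x y => (γ x).left⁻¹ * (γ y).left) (cellFrontier 1 e)
      (cellFrontier 1 e), hF.biUnion fun e _ => (hfr e).image2 _ (hfr e), ?_⟩
  set S := ⋃ e ∈ F, Set.image2 (fun x y => (γ x).left⁻¹ * (γ y).left) (cellFrontier 1 e)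
    (cellFrontier 1 e)
  unfold GeneratesOver
  set H := Subgroup.closure {x : B | ∃ s ∈ S, ∃ a ∈ horoballVertices b τ ⌊t - lag t - D⌋,
    x = φ a s}
  have hedge : ∀ e : cell (Set.univ : Set 𝒟.X) 1,
      closedCell 1 e ⊆ 𝒟.h ⁻¹' horoball τ (t - lag t) →
      ∀ v w, 𝒟.vertexPoint v ∈ cellFrontier 1 e → 𝒟.vertexPoint w ∈ cellFrontier 1 e →
      (γ (𝒟.vertexPoint v)).left⁻¹ * (γ (𝒟.vertexPoint w)).left ∈ H := by
    intro e he v w hv hw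
    obtain ⟨e', he', g, hg⟩ := hForb e
    have hgc : (fun x : 𝒟.X => g • x) '' closedCell 1 e' = closedCell 1 e := by
      obtain ⟨e'', h1, h2⟩ := exists_smul_cell g 1 e'
      rwa [openCell_congr 1 (h1.symm.trans hg)] at h2
    have hpull : ∀ v, 𝒟.vertexPoint v ∈ cellFrontier 1 e → ∃ v', 𝒟.vertexPoint v' ∈
        cellFrontier 1 e' ∧ g • 𝒟.vertexPoint v' = 𝒟.vertexPoint v := by
      intro v hv
      obtain ⟨v', hv'⟩ := exists_smul_vertexPoint g⁻¹ v
      have hgv : g • 𝒟.vertexPoint v' = 𝒟.vertexPoint v := by rw [hv', smul_inv_smul]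
      refine ⟨v', ?_, hgv⟩
      have h1 : 𝒟.vertexPoint v ∈ (fun x : 𝒟.X => g • x) '' closedCell 1 e' := by
        rw [hgc]
        exact cellFrontier_subset_closedCell 1 e hv
      obtain ⟨x, hx, hxv⟩ := h1
      -- The translated vertex lies in the closed edge `e'`, and not in its interior, since open
      -- cells of different dimensions are disjoint.
      have hxv' : x = 𝒟.vertexPoint v' := MulAction.injective g (hxv.trans hgv.symm)
      rw [hxv', ← cellFrontier_union_openCell_eq_closedCell] at hx
      refine hx.resolve_right fun hopen => ?_
      have h2 : 𝒟.vertexPoint v' ∈ openCell 0 v' := by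
        rw [openCell_zero]
        rfl
      cases sigma_eq_of_mem_openCell hopen h2
    obtain ⟨v', hv', hgv⟩ := hpull v hv
    obtain ⟨w', hw', hgw⟩ := hpull w hw
    rw [← hgv, ← hgw, hγ, hγ]
    refine Subgroup.subset_closure ⟨(γ (𝒟.vertexPoint v')).left⁻¹ * (γ (𝒟.vertexPoint w')).left,
      Set.mem_biUnion he' (Set.mem_image2_of_mem hv' hw'), g.right, ?_, ?_⟩
    · have h1 : 𝒟.h (𝒟.vertexPoint v) ∈ horoball τ (t - lag t) :=
        he (cellFrontier_subset_closedCell 1 e hv)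
      have h2 := semidirectAction_vertex (b := b) g 1
      rw [mul_one] at h2
      -- The vertex `g.right` is within `D` of the control image of the edge, whence the index `⌊t -
      -- lag t - D⌋`.
      refine horoball_antitone τ (Int.floor_le _) (mem_horoball_of_dist_le h1 ?_)
      rw [← hgv, 𝒟.equivariant_h g _ (vertexPoint_mem_skeleton v'), ← h2,
        IsometryEquiv.dist_eq]
      exact hD e' he' _ (cellFrontier_subset_closedCell 1 e' hv')
    · simp [mul_assoc]
  refine top_unique fun β _ => ?_
  set c := (γ (𝒟.vertexPoint v₀)).left with hc
  -- Conjugating by `c` makes the label of `g • v₀` have `B`-part `c * β`, so the difference from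
  -- `c` is exactly `β`.
  set g : B ⋊[φ] A := SemidirectProduct.inl (c * β * c⁻¹) with hgdef
  obtain ⟨v₁, hv₁⟩ := exists_smul_vertexPoint g v₀
  have hγ₁ : c⁻¹ * (γ (𝒟.vertexPoint v₁)).left = β := by
    rw [hv₁, hγ, SemidirectProduct.mul_left, ← hc]
    simp [hgdef]
  have h₁ : 𝒟.h (𝒟.vertexPoint v₁) ∈ horoball τ t := by
    rw [hv₁, 𝒟.equivariant_h g _ (vertexPoint_mem_skeleton v₀), semidirectAction_inl]
    exact ht
  have hpath := hlag t _ (vertexPoint_mem_sublevel_iff.2 ht) _ (vertexPoint_mem_sublevel_iff.2 h₁)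
  have hmem : ∀ v, 𝒟.vertexPoint v ∈ 𝒟.sublevel τ (t - lag t) →
      v ∈ (𝒟.sublevelSubcomplex τ (t - lag t)).I 0 := by
    intro v hv
    refine ⟨zero_le_one, ?_⟩
    rw [closedCell_zero]
    exact Set.singleton_subset_iff.2 (vertexPoint_mem_sublevel_iff.1 hv)
  have hrange : Set.range hpath.somePath ⊆ 𝒟.sublevel τ (t - lag t) :=
    Set.range_subset_iff.2 hpath.somePath_mem
  -- The ambient complex is the sublevel set, so only edges covered by `hedge` occur, and the path
  -- carries membership in `H` from `v₀` to `v₁`.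
  have hfinal := mem_of_isPreconnected
    (C := (𝒟.sublevelSubcomplex τ (t - lag t) : Set 𝒟.X))
    (K := {v : (𝒟.sublevelSubcomplex τ (t - lag t)).I 0 |
      c⁻¹ * (γ (𝒟.vertexPoint v.1)).left ∈ H})
    (fun e v w hv hw hvK => by
      have := H.mul_mem hvK (hedge e.1 e.2.2 v.1 w.1 hv hw)
      rwa [mul_assoc, mul_inv_cancel_left] at this)
    (isPreconnected_range hpath.somePath.continuous) hrange
    (v := (⟨v₀, hmem v₀ hpath.source_mem⟩ : (𝒟.sublevelSubcomplex τ (t - lag t)).I 0))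
    (w := (⟨v₁, hmem v₁ hpath.target_mem⟩ : (𝒟.sublevelSubcomplex τ (t - lag t)).I 0))
    ⟨0, hpath.somePath.source⟩ ⟨1, hpath.somePath.target⟩
    (by
      change c⁻¹ * c ∈ H
      rw [inv_mul_cancel]
      exact H.one_mem)
  change c⁻¹ * (γ (𝒟.vertexPoint v₁)).left ∈ H at hfinal
  rwa [hγ₁] at hfinal

end Necessary

theorem theorem2 {ι A B : Type*} [Finite ι] [Group A] [Group B]
    (b : FreeGroupBasis ι A) (φ : A →* MulAut B) (_hG : Group.FG (B ⋊[φ] A))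
    (𝒟 : ControlData (semidirectAction b φ)) (τ : GeodesicRay (CayleyTree b)) :
    ((∃ S : Set B, S.Finite ∧
        ∀ k : ℤ, 0 ≤ k → GeneratesOver φ S (horoballVertices b τ k)) →
      τ.endpoint ∈ 𝒟.Sigma1) ∧
    ((∀ k : ℤ, k ≤ 0 → ¬ FinitelyGeneratedOver φ (horoballVertices b τ k)) →
      τ.endpoint ∉ 𝒟.Sigma1) := by
  refine ⟨fun ⟨S, hSf, hS⟩ => ⟨τ, rfl, isControlledConnected_of_generatesOver 𝒟 τ hSf hS⟩, ?_⟩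
  rintro h ⟨σ, hσ, hcc⟩
  obtain ⟨k, hk⟩ := finitelyGeneratedOver_of_isControlledConnected 𝒟 σ hcc
  obtain ⟨r, hr⟩ := exists_horoball_subset_of_endpoint_eq hσ
  -- Lowering the index enlarges the horoball and preserves finite generation, so it can be made
  -- nonpositive.
  refine h (min 0 ⌊(k : ℝ) - r⌋) (min_le_left _ _) (hk.mono fun a ha => ?_)
  refine horoball_antitone τ ?_ (hr k ha)
  exact le_trans (by exact_mod_cast min_le_right 0 ⌊(k : ℝ) - r⌋) (Int.floor_le _)
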